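/- **Setting.** Let $m\ge 1$. A *reference family* is a finite family $\mathfrak R=(R_k,\zeta_k)_{k\in\mathcal K}$ of pairwise distinct regions $R_k\subseteq\{1,\dots,m\}$ and integers $\zeta_k\in\{0,\dots,|R_k|\}$. Put $$V^*_{\mathfrak R}(S)=\max\{|S\cap A| : A\subseteq\{1,\dots,m\},\ |R_k\cap A|\le\zeta_k \text{ for all } k\in\mathcal K\},\qquad S\subseteq\{1,\dots,m\}.$$ Assume that $\mathfrak R$ has *forest structure*, i.e. any two regions are disjoint or nested. The *atoms* are the classes of the equivalence relation "$i$ and $j$ lie in exactly the same regions" on $\{1,\dots,m\}$; a *leaf* is a $k\in\mathcal K$ for which $R_k$ is an atom. Assume that $\mathfrak R$ is *complete*, i.e. every atom is a region of the family. The *depth* of $k$ is $\phi(k)=1+|\{k'\in\mathcal K: R_k\subsetneq R_{k'}\}|$, and $\mathcal K^h=\{k\in\mathcal K:\phi(k)=h\}$. A set $Q\subseteq\mathcal K$ *realizes a partition* if the $R_k$, $k\in Q$, are non-empty, pairwise disjoint and have union $\{1,\dots,m\}$. Let $(i_1,\dots,i_m)$ be a permutation of $\{1,\dots,m\}$ and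 $S_t=\{i_1,\dots,i_t\}$ for $0\le t\le m$ (so $S_0=\varnothing$). Let $k^{(t,h)}$ be the unique element of $\mathcal K^h$ with $i_t\in R_{k^{(t,h)}}$, if there is one, and let $h_{\max}(t)$ be the largest $h$ for which $k^{(t,h)}$ exists. **Algorithm.** Let $\mathcal P^0$ be the set of all leaves, $\mathcal K^-_0=\{k\in\mathcal K:\zeta_k=0\}$ and $\eta^0_k=0$ for all $k\in\mathcal K$. For $t=1,\dots,m$, start from $\mathcal P^t=\mathcal P^{t-1}$, $\mathcal K^-_t=\mathcal K^-_{t-1}$, $\eta^t=\eta^{t-1}$. If $i_t\in\bigcup_{k\in\mathcal K^-_{t-1}}R_k$, change nothing. Otherwise, for $h=1,\dots,h_{\max}(t)$ in turn, set $k=k^{(t,h)}$ and $\eta^t_k=\eta^{t-1}_k+1$; if then $\eta^t_k\ge\zeta_k$, replace $\mathcal P^t$ by $(\mathcal P^{t-1}\setminus\{k'\in\mathcal P^{t-1}:R_{k'}\subseteq R_k\})\cup\{k\}$ and $\mathcal K^-_t$ by $\mathcal K^-_{t-1}\cup\{k\}$, and leave the loop over $h$. Let $\mathcal K_t=\{k\in\mathcal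 K:\ R_{k'}\subseteq R_k\text{ for some }k'\in\mathcal P^t\}$. **Theorem (Fast curve computation).** Let $0\le t\le m$. Then $\mathcal P^t$ realizes a partition, $$V^*_{\mathfrak R}(S_t\cap R_k)=\eta^t_k\quad\text{for all }k\in\mathcal K_t,\qquad\text{and}\qquad V^*_{\mathfrak R}(S_t)=\sum_{k\in\mathcal K^1}\eta^t_k .$$ If moreover $\zeta_l=0$ for every leaf $l$ whose region is contained in a region $R_k$ with $\zeta_k=0$ (for instance, if $\zeta_k\ge1$ for every $k$ that is not a leaf), then also $$V^*_{\mathfrak R}(S_t\cap R_k)=\sum_{\substack{k'\in\mathcal P^t\\ R_{k'}\subseteq R_k}}\min(\zeta_{k'},|S_t\cap R_{k'}|)\quad\text{for all }k\in\mathcal K_t,\qquad\text{and}\qquad V^*_{\mathfrak R}(S_t)=\sum_{k\in\mathcal P^t}\min(\zeta_k,|S_t\cap R_k|).$$ -/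

import Mathlib

open Finset

/-- A reference family `(R_k, ζ_k)_{k ∈ K}` on `m` hypotheses, which are labelled by `Fin m`:
pairwise distinct regions `R k`, with integers `0 ≤ ζ k ≤ |R k|`. -/
structure ReferenceFamily (m : ℕ) (K : Type*) where
  R : K → Finset (Fin m)
  ζ : K → ℕ
  R_injective : Function.Injective R
  ζ_le : ∀ k, ζ k ≤ (R k).card

/-- The variables of the curve algorithm after a given step: the set `𝒫^t`, the set `𝒦⁻_t`
and the counters `η^t_k`. -/
structure CurveState (K : Type*) where
  P : Finset K
  Kminus : Finset K
  η : K → ℕ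

namespace ReferenceFamily

/-- Forest structure: any two regions are disjoint or nested. -/
def IsForest {m : ℕ} {K : Type*} (F : ReferenceFamily m K) : Prop :=
  ∀ k k' : K, F.R k ∩ F.R k' = F.R k ∨ F.R k ∩ F.R k' = F.R k' ∨ F.R k ∩ F.R k' = ∅

/-- The sets `A` of hypotheses with `|R_k ∩ A| ≤ ζ_k` for all `k`. -/
def admissible {m : ℕ} {K : Type*} [Fintype K] (F : ReferenceFamily m K) :
    Finset (Finset (Fin m)) :=
  univ.filter fun A => ∀ k : K, (F.R k ∩ A).card ≤ F.ζ k

theorem admissible_nonempty {m : ℕ} {K : Type*} [Fintype K] (F : ReferenceFamily m K) :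
    F.admissible.Nonempty :=
  ⟨∅, by simp [admissible]⟩

/-- The bound `V*(S)`, the maximum of `|S ∩ A|` over the admissible sets `A`. -/
def vstar {m : ℕ} {K : Type*} [Fintype K] (F : ReferenceFamily m K) (S : Finset (Fin m)) : ℕ :=
  F.admissible.sup' F.admissible_nonempty fun A => (S ∩ A).card

/-- The atom of the hypothesis `i`: the hypotheses that lie in exactly the same regions as `i`.
The atoms form the coarsest partition such that every region is a union of parts. -/
def atom {m : ℕ} {K : Type*} [Fintype K] (F : ReferenceFamily m K) (i : Fin m) :
    Finset (Fin m) :=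
  univ.filter fun j => ∀ k : K, i ∈ F.R k ↔ j ∈ F.R k

/-- The family is complete: all atoms are regions of the family. -/
def IsComplete {m : ℕ} {K : Type*} [Fintype K] (F : ReferenceFamily m K) : Prop :=
  ∀ i : Fin m, ∃ k : K, F.R k = F.atom i

/-- The indices of the regions that are atoms (leaves). -/
def leaves {m : ℕ} {K : Type*} [Fintype K] (F : ReferenceFamily m K) : Finset K :=
  univ.filter fun k => ∃ i : Fin m, F.R k = F.atom i

/-- The regions `R_k`, `k ∈ Q`, form a partition of the set of all hypotheses. -/
def RealizesPartition {m : ℕ} {K : Type*} (F : ReferenceFamily m K) (Q : Finset K) : Prop :=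
  (∀ k ∈ Q, (F.R k).Nonempty) ∧
  (∀ k ∈ Q, ∀ k' ∈ Q, k ≠ k' → Disjoint (F.R k) (F.R k')) ∧
  (∀ i : Fin m, ∃ k ∈ Q, i ∈ F.R k)

/-- The depth `φ(k) = 1 + |{k' : R_k ⊊ R_{k'}}|`. -/
def depth {m : ℕ} {K : Type*} [Fintype K] (F : ReferenceFamily m K) (k : K) : ℕ :=
  1 + (univ.filter fun k' : K => F.R k ⊂ F.R k').card

/-- `𝒦^h`, the indices of depth `h`. -/
def level {m : ℕ} {K : Type*} [Fintype K] (F : ReferenceFamily m K) (h : ℕ) : Finset K :=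
  univ.filter fun k => F.depth k = h

/-- The index of depth `h` whose region contains the hypothesis `x`, if it exists
(there is at most one for a forest); for `x = i_t` this is `k^{(t,h)}`. -/
def regionAt {m : ℕ} {K : Type*} [Fintype K] [DecidableEq K] (F : ReferenceFamily m K)
    (x : Fin m) (h : ℕ) : Option K :=
  if hx : ∃ k : K, (F.depth k = h ∧ x ∈ F.R k) ∧ ∀ k' : K, F.depth k' = h ∧ x ∈ F.R k' → k' = k then
    some (Fintype.choose (fun k : K => F.depth k = h ∧ x ∈ F.R k) hx)
  else none

/-- The largest depth of a region containing `x`; for `x = i_t` this is `h_max(t)`. -/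
def hmax {m : ℕ} {K : Type*} [Fintype K] (F : ReferenceFamily m K) (x : Fin m) : ℕ :=
  (univ.filter fun k : K => x ∈ F.R k).sup F.depth

/-- The loop over the depths `h` in the given list, for the hypothesis `x`: increment the counter
of the region of depth `h` containing `x`; when that counter is no longer below `ζ`, update `𝒫`
and `𝒦⁻` and break the loop. -/
def depthLoop {m : ℕ} {K : Type*} [Fintype K] [DecidableEq K] (F : ReferenceFamily m K)
    (x : Fin m) : List ℕ → CurveState K → CurveState K
  | [], s => s
  | h :: hs, s =>
    match F.regionAt x h with
    | none => F.depthLoop x hs s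
    | some k =>
      if s.η k + 1 < F.ζ k then
        F.depthLoop x hs { s with η := Function.update s.η k (s.η k + 1) }
      else
        { P := (s.P \ s.P.filter fun k' => F.R k' ⊆ F.R k) ∪ {k}
          Kminus := s.Kminus ∪ {k}
          η := Function.update s.η k (s.η k + 1) }

/-- The initial state: `𝒫^0` is the set of all atoms, `𝒦⁻_0 = {k : ζ_k = 0}`, `η^0 = 0`. -/
def initState {m : ℕ} {K : Type*} [Fintype K] (F : ReferenceFamily m K) : CurveState K where
  P := F.leaves
  Kminus := univ.filter fun k => F.ζ k = 0
  η := fun _ => 0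

/-- One step of the algorithm, processing the hypothesis `x`. -/
def step {m : ℕ} {K : Type*} [Fintype K] [DecidableEq K] (F : ReferenceFamily m K)
    (x : Fin m) (s : CurveState K) : CurveState K :=
  if ∃ k ∈ s.Kminus, x ∈ F.R k then s
  else F.depthLoop x (List.range' 1 (F.hmax x)) s

/-- The state after step `t ≤ m` along the ordering `i_1 = σ 0, …, i_m = σ (m - 1)` of the
hypotheses (after step `m` nothing changes any more). -/
def curveState {m : ℕ} {K : Type*} [Fintype K] [DecidableEq K] (F : ReferenceFamily m K)
    (σ : Equiv.Perm (Fin m)) : ℕ → CurveState K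
  | 0 => F.initState
  | t + 1 => if ht : t < m then F.step (σ ⟨t, ht⟩) (F.curveState σ t) else F.curveState σ t

/-- `𝒦_t`, the indices `k` such that `R_{k'} ⊆ R_k` for some `k' ∈ 𝒫^t`. -/
def above {m : ℕ} {K : Type*} [Fintype K] [DecidableEq K] (F : ReferenceFamily m K)
    (σ : Equiv.Perm (Fin m)) (t : ℕ) : Finset K :=
  univ.filter fun k => ∃ k' ∈ (F.curveState σ t).P, F.R k' ⊆ F.R k

end ReferenceFamily

/-- The selection set `S_t = {i_1, …, i_t}` with `i_1 = σ 0, …, i_m = σ (m - 1)`. -/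
def selectionPath {m : ℕ} (σ : Equiv.Perm (Fin m)) (t : ℕ) : Finset (Fin m) :=
  (univ.filter fun j : Fin m => (j : ℕ) < t).image σ

namespace ReferenceFamily

variable {m : ℕ} {K : Type*} {F : ReferenceFamily m K}

/-! Add the hypotheses one at a time and call a region $R_k$ saturated when $V^*(S\cap
R_k)=\zeta_k$. If $x$ lies in no saturated region, any admissible $A\subseteq S$ can be enlarged by
$x$, so the bound grows by one on every set containing $x$ (`vstar_insert_of_unsaturated`). If $x$
lies in a saturated $R_k$, an exchange inside $R_k$ shows that $x$ adds nothing on sets containing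
$R_k$ (`IsForest.vstar_insert_of_saturated`).

The algorithm follows this dichotomy: $\mathcal K^-$ records saturated regions, and $\eta_k$ equals
the bound as long as $R_k$ contains a part of $\mathcal P$. When a region saturates, it absorbs the
parts inside it; counters strictly below it go stale, but those regions have left $\mathcal K_t$.
`CurveInvariant` collects these facts, and `CurveInvariant.step` preserves them. -/

theorem IsForest.subset_or_subset_or_disjoint (hF : F.IsForest) (k k' : K) :
    F.R k ⊆ F.R k' ∨ F.R k' ⊆ F.R k ∨ Disjoint (F.R k) (F.R k') := by
  rcases hF k k' with h | h | h
  · exact .inl (inter_eq_left.1 h)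
  · exact .inr (.inl (inter_eq_right.1 h))
  · exact .inr (.inr (disjoint_iff_inter_eq_empty.2 h))

theorem IsForest.subset_or_subset (hF : F.IsForest) {k k' : K} {x : Fin m}
    (hk : x ∈ F.R k) (hk' : x ∈ F.R k') : F.R k ⊆ F.R k' ∨ F.R k' ⊆ F.R k := by
  rcases hF.subset_or_subset_or_disjoint k k' with h | h | h
  · exact .inl h
  · exact .inr h
  · exact absurd hk' (disjoint_left.1 h hk)

variable [Fintype K]

/-! ### Admissible sets and elementary properties of $V^*$. -/

theorem mem_admissible {A : Finset (Fin m)} :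
    A ∈ F.admissible ↔ ∀ k, (F.R k ∩ A).card ≤ F.ζ k := by
  simp [admissible]

theorem mem_admissible_of_subset {A B : Finset (Fin m)} (hA : A ∈ F.admissible) (h : B ⊆ A) :
    B ∈ F.admissible :=
  mem_admissible.2 fun k =>
    (card_le_card (inter_subset_inter_left h)).trans (mem_admissible.1 hA k)

theorem card_le_vstar {A S : Finset (Fin m)} (hA : A ∈ F.admissible) (h : A ⊆ S) :
    A.card ≤ F.vstar S := by
  have := le_sup' (fun A => (S ∩ A).card) hA
  rwa [inter_eq_right.2 h] at this

/-- Admissibility passes to subsets, so a maximizer may be cut down to $S$. With `card_le_vstar`,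
this makes $V^*(S)$ the largest size of an admissible subset of $S$. -/
theorem exists_card_eq_vstar (F : ReferenceFamily m K) (S : Finset (Fin m)) :
    ∃ A ∈ F.admissible, A ⊆ S ∧ A.card = F.vstar S := by
  obtain ⟨A, hA, h⟩ := exists_mem_eq_sup' F.admissible_nonempty fun A => (S ∩ A).card
  exact ⟨S ∩ A, mem_admissible_of_subset hA inter_subset_right, inter_subset_left, h.symm⟩

theorem vstar_le_card (F : ReferenceFamily m K) (S : Finset (Fin m)) : F.vstar S ≤ S.card := by
  obtain ⟨A, -, hAS, h⟩ := F.exists_card_eq_vstar S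
  exact h ▸ card_le_card hAS

theorem vstar_mono {S T : Finset (Fin m)} (h : S ⊆ T) : F.vstar S ≤ F.vstar T := by
  obtain ⟨A, hA, hAS, h'⟩ := F.exists_card_eq_vstar S
  exact h' ▸ card_le_vstar hA (hAS.trans h)

theorem vstar_inter_region_le (F : ReferenceFamily m K) (S : Finset (Fin m)) (k : K) :
    F.vstar (S ∩ F.R k) ≤ F.ζ k := by
  obtain ⟨A, hA, hAS, h⟩ := F.exists_card_eq_vstar (S ∩ F.R k)
  have := mem_admissible.1 hA k
  rwa [inter_eq_right.2 (hAS.trans inter_subset_right), h] at this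

@[simp]
theorem vstar_empty (F : ReferenceFamily m K) : F.vstar ∅ = 0 :=
  Nat.le_zero.1 (F.vstar_le_card ∅)

/-- If no region containing `x` is saturated by `S`, then adding `x` increases the bound by one. -/
theorem vstar_insert_of_unsaturated {x : Fin m} {S T : Finset (Fin m)} (hxS : x ∉ S) (hxT : x ∈ T)
    (h : ∀ k, x ∈ F.R k → F.vstar (S ∩ F.R k) < F.ζ k) :
    F.vstar (insert x S ∩ T) = F.vstar (S ∩ T) + 1 := by
  rw [insert_inter_of_mem hxT]
  apply le_antisymm
  · obtain ⟨A, hA, hAS, h'⟩ := F.exists_card_eq_vstar (insert x (S ∩ T))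
    have h1 : (A.erase x).card ≤ F.vstar (S ∩ T) :=
      card_le_vstar (mem_admissible_of_subset hA (erase_subset _ _)) (subset_insert_iff.1 hAS)
    have := pred_card_le_card_erase (s := A) (a := x)
    omega
  · obtain ⟨A, hA, hAS, h'⟩ := F.exists_card_eq_vstar (S ∩ T)
    have hxA : x ∉ A := fun hx => hxS (mem_inter.1 (hAS hx)).1
    rw [← h', ← card_insert_of_notMem hxA]
    refine card_le_vstar (mem_admissible.2 fun k => ?_) (insert_subset_insert _ hAS)
    by_cases hk : x ∈ F.R k
    -- $R_k\cap A$ is an admissible subset of $S\cap R_k$, so strict inequality leaves room for $x$.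
    · have h1 : (F.R k ∩ A).card ≤ F.vstar (S ∩ F.R k) :=
        card_le_vstar (mem_admissible_of_subset hA inter_subset_right) fun y hy =>
          mem_inter.2 ⟨(mem_inter.1 (hAS (mem_inter.1 hy).2)).1, (mem_inter.1 hy).1⟩
      rw [inter_insert_of_mem hk]
      have := card_insert_le x (F.R k ∩ A)
      have := h k hk
      omega
    · rw [inter_insert_of_notMem hk]
      exact mem_admissible.1 hA k

/-- Adding an element of a saturated region does not change the bound on any larger set. -/
theorem IsForest.vstar_insert_of_saturated (hF : F.IsForest) {x : Fin m} {S T : Finset (Fin m)}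
    {k : K} (hx : x ∈ F.R k) (hk : F.vstar (S ∩ F.R k) = F.ζ k) (hT : F.R k ⊆ T) :
    F.vstar (insert x S ∩ T) = F.vstar (S ∩ T) := by
  refine le_antisymm ?_ (vstar_mono (inter_subset_inter_right (subset_insert _ _)))
  obtain ⟨A, hA, hAS, hAc⟩ := F.exists_card_eq_vstar (insert x S ∩ T)
  obtain ⟨B, hB, hBS, hBc⟩ := F.exists_card_eq_vstar (S ∩ F.R k)
  -- The exchange: $A\cap R_k$ is replaced by an equally large $C\subseteq B$, which avoids $x$
  -- unless $x\in S$. Enough room exists because $|A\cap R_k|\le\zeta_k=|B|$.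
  obtain ⟨C, hCB, hCc⟩ := exists_subset_card_eq
    ((mem_admissible.1 hA k).trans (hk.symm.trans hBc.symm).le)
  have hC := mem_admissible_of_subset hB hCB
  have hCS := hCB.trans hBS
  have hCk : C ⊆ F.R k := hCS.trans inter_subset_right
  have hdisj : Disjoint (A \ F.R k) C := disjoint_sdiff_self_left.mono_right hCk
  have hcard : ∀ U : Finset (Fin m), F.R k ⊆ U →
      (U ∩ (A \ F.R k ∪ C)).card = (U ∩ A).card := by
    intro U hU
    rw [inter_union_distrib_left, card_union_of_disjoint
      (hdisj.mono inter_subset_right inter_subset_right), inter_eq_right.2 (hCk.trans hU), hCc,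
      ← card_sdiff_add_card_inter (U ∩ A) (F.R k)]
    congr 2
    · ext y; simp; tauto
    · ext y; simp only [mem_inter]; exact ⟨fun h => ⟨⟨hU h.1, h.2⟩, h.1⟩, fun h => ⟨h.2, h.1.2⟩⟩
  have hadm : A \ F.R k ∪ C ∈ F.admissible := by
    refine mem_admissible.2 fun l => ?_
    -- A region inside $R_k$ sees only $C$, one containing $R_k$ sees an unchanged count, and one
    -- disjoint from $R_k$ sees only $A$.
    rcases hF.subset_or_subset_or_disjoint l k with h | h | h
    · refine (card_le_card fun y hy => ?_).trans (mem_admissible.1 hC l)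
      simp only [mem_inter, mem_union, mem_sdiff] at hy ⊢
      exact ⟨hy.1, hy.2.resolve_left fun h' => h'.2 (h hy.1)⟩
    · exact (hcard _ h).trans_le (mem_admissible.1 hA l)
    · refine (card_le_card fun y hy => ?_).trans (mem_admissible.1 hA l)
      simp only [mem_inter, mem_union, mem_sdiff] at hy ⊢
      exact ⟨hy.1, (hy.2.resolve_right fun h' => disjoint_left.1 h hy.1 (hCk h')).1⟩
  have hu := hcard univ (subset_univ _)
  simp only [univ_inter] at hu
  rw [← hAc, ← hu]
  refine card_le_vstar hadm fun y hy => ?_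
  rcases mem_union.1 hy with hy | hy
  · rw [mem_sdiff] at hy
    have := hAS hy.1
    rw [mem_inter, mem_insert] at this
    exact mem_inter.2 ⟨this.1.resolve_left fun h => hy.2 (h ▸ hx), this.2⟩
  · exact mem_inter.2 ⟨(mem_inter.1 (hCS hy)).1, hT (hCk hy)⟩

/-- An element of a region with `ζ = 0` lies in no admissible set. -/
theorem vstar_insert_of_zeta_eq_zero {x : Fin m} {k : K} (hx : x ∈ F.R k) (hk : F.ζ k = 0)
    (S T : Finset (Fin m)) : F.vstar (insert x S ∩ T) = F.vstar (S ∩ T) := by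
  refine le_antisymm ?_ (vstar_mono (inter_subset_inter_right (subset_insert _ _)))
  obtain ⟨A, hA, hAS, hAc⟩ := F.exists_card_eq_vstar (insert x S ∩ T)
  rw [← hAc]
  refine card_le_vstar hA fun y hy => ?_
  have h1 := hAS hy
  rw [mem_inter, mem_insert] at h1
  refine mem_inter.2 ⟨h1.1.resolve_left ?_, h1.2⟩
  rintro rfl
  have h2 := mem_admissible.1 hA k
  rw [hk, Nat.le_zero, card_eq_zero] at h2
  exact notMem_empty y (h2 ▸ mem_inter.2 ⟨hx, hy⟩)

/-! ### Leaves and depth. -/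

theorem mem_atom_self (F : ReferenceFamily m K) (i : Fin m) : i ∈ F.atom i := by simp [atom]

theorem mem_leaves {k : K} : k ∈ F.leaves ↔ ∃ i, F.R k = F.atom i := by simp [leaves]

/-- A leaf is contained in every region that it meets. -/
theorem subset_of_mem_leaves {l k : K} {x : Fin m} (hl : l ∈ F.leaves) (hxl : x ∈ F.R l)
    (hxk : x ∈ F.R k) : F.R l ⊆ F.R k := by
  obtain ⟨i, hi⟩ := mem_leaves.1 hl
  intro y hy
  rw [hi] at hxl hy
  simp only [atom, mem_filter, mem_univ, true_and] at hxl hy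
  exact (hy k).1 ((hxl k).2 hxk)

theorem eq_of_mem_leaves {l l' : K} {x : Fin m} (hl : l ∈ F.leaves) (hl' : l' ∈ F.leaves)
    (hx : x ∈ F.R l) (hx' : x ∈ F.R l') : l = l' :=
  F.R_injective <|
    (subset_of_mem_leaves hl hx hx').antisymm (subset_of_mem_leaves hl' hx' hx)

theorem realizesPartition_leaves (hc : F.IsComplete) : F.RealizesPartition F.leaves := by
  refine ⟨fun k hk => ?_, fun k hk k' hk' hne => disjoint_left.2 fun x hx hx' =>
    hne (eq_of_mem_leaves hk hk' hx hx'), fun i => ?_⟩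
  · obtain ⟨i, hi⟩ := mem_leaves.1 hk
    exact ⟨i, hi ▸ F.mem_atom_self i⟩
  · obtain ⟨k, hk⟩ := hc i
    exact ⟨k, mem_leaves.2 ⟨i, hk⟩, hk ▸ F.mem_atom_self i⟩

theorem depth_lt_of_ssubset {k k' : K} (h : F.R k ⊂ F.R k') : F.depth k' < F.depth k := by
  refine Nat.add_lt_add_left (card_lt_card ⟨fun l hl => ?_, fun hs => ?_⟩) 1
  · simp only [mem_filter, mem_univ, true_and] at hl ⊢
    exact h.trans hl
  · have : k' ∈ univ.filter fun l => F.R k' ⊂ F.R l := hs (by simpa using h)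
    simp at this

/-- The regions through $x$ form a chain on which depth reverses inclusion; this turns the loop's
conditions on depth into inclusions. -/
theorem IsForest.subset_of_depth_le (hF : F.IsForest) {k k' : K} {x : Fin m}
    (hk : x ∈ F.R k) (hk' : x ∈ F.R k') (h : F.depth k ≤ F.depth k') : F.R k' ⊆ F.R k := by
  by_contra hn
  have h1 := (hF.subset_or_subset hk hk').resolve_right hn
  exact absurd (depth_lt_of_ssubset ⟨h1, hn⟩) (by omega)

theorem IsForest.eq_of_depth_eq (hF : F.IsForest) {k k' : K} {x : Fin m}
    (hk : x ∈ F.R k) (hk' : x ∈ F.R k') (h : F.depth k = F.depth k') : k = k' :=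
  F.R_injective <|
    (hF.subset_of_depth_le hk' hk h.ge).antisymm (hF.subset_of_depth_le hk hk' h.le)

theorem exists_depth_eq_one {x : Fin m} {k : K} (hk : x ∈ F.R k) :
    ∃ k', x ∈ F.R k' ∧ F.depth k' = 1 := by
  obtain ⟨k', hk', hmax⟩ := exists_max_image (univ.filter fun k => x ∈ F.R k)
    (fun k => (F.R k).card) ⟨k, by simpa using hk⟩
  simp only [mem_filter, mem_univ, true_and] at hk' hmax
  refine ⟨k', hk', ?_⟩
  rw [depth, Nat.add_eq_left, card_eq_zero, filter_eq_empty_iff]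
  intro l _ hl
  exact absurd (card_lt_card hl) (not_lt.2 (hmax l (hl.1 hk')))

theorem one_le_depth (F : ReferenceFamily m K) (k : K) : 1 ≤ F.depth k := Nat.le_add_right _ _

theorem depth_le_hmax {x : Fin m} {k : K} (hk : x ∈ F.R k) : F.depth k ≤ F.hmax x :=
  le_sup (f := F.depth) (by simpa using hk)

/-! ### The invariant and its initial case. -/

/-- The relation between a selection set `S` and the state `s` of the curve algorithm that is
preserved by its steps. -/
structure CurveInvariant (F : ReferenceFamily m K) (S : Finset (Fin m)) (s : CurveState K) :
    Prop where
  partition : F.RealizesPartition s.P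
  vstar_eq : ∀ k, (∃ p ∈ s.P, F.R p ⊆ F.R k) → F.vstar (S ∩ F.R k) = s.η k
  saturated : ∀ k ∈ s.Kminus, F.vstar (S ∩ F.R k) = F.ζ k
  -- Regions with $\zeta_k=0$ are frozen from the start without being absorbed into $\mathcal P$,
  -- hence the first alternative.
  covered : ∀ k ∈ s.Kminus, F.ζ k = 0 ∨ ∃ p ∈ s.P, F.R k ⊆ F.R p
  leaf_or_mem : ∀ p ∈ s.P, p ∈ F.leaves ∨ p ∈ s.Kminus
  unsaturated : ∀ k, (∃ p ∈ s.P, F.R p ⊆ F.R k) → k ∉ s.Kminus → F.vstar (S ∩ F.R k) < F.ζ k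
  vstar_eq_sum : ∀ T, (T = univ ∨ ∃ k, (∃ p ∈ s.P, F.R p ⊆ F.R k) ∧ T = F.R k) →
    F.vstar (S ∩ T) = ∑ p ∈ s.P with F.R p ⊆ T, F.vstar (S ∩ F.R p)
  vstar_eq_level : F.vstar S = ∑ k ∈ F.level 1, s.η k
  vstar_eq_min : (∀ k, F.ζ k = 0 → ∀ l ∈ F.leaves, F.R l ⊆ F.R k → F.ζ l = 0) →
    ∀ p ∈ s.P, F.vstar (S ∩ F.R p) = min (F.ζ p) (S ∩ F.R p).card

theorem curveInvariant_initState (hc : F.IsComplete) : F.CurveInvariant ∅ F.initState where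
  partition := realizesPartition_leaves hc
  vstar_eq k _ := by simp [initState]
  saturated k hk := by
    have : F.ζ k = 0 := by simpa [initState] using hk
    simp [this]
  covered k hk := .inl (by simpa [initState] using hk)
  leaf_or_mem p hp := .inl hp
  unsaturated k _ hk := by
    have : F.ζ k ≠ 0 := by simpa [initState] using hk
    simpa using Nat.pos_of_ne_zero this
  vstar_eq_sum T _ := by simp
  vstar_eq_level := by simp [initState]
  vstar_eq_min _ p _ := by simp

variable [DecidableEq K]

/-! ### The loop over depths. -/

theorem regionAt_eq_some {x : Fin m} {h : ℕ} {k : K} (hk : F.regionAt x h = some k) :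
    F.depth k = h ∧ x ∈ F.R k := by
  unfold regionAt at hk
  split_ifs at hk with hx
  cases hk
  exact Fintype.choose_spec (fun k : K => F.depth k = h ∧ x ∈ F.R k) hx

theorem IsForest.regionAt_depth (hF : F.IsForest) {x : Fin m} {k : K} (hk : x ∈ F.R k) :
    F.regionAt x (F.depth k) = some k := by
  cases h : F.regionAt x (F.depth k) with
  | none =>
    unfold regionAt at h
    split_ifs at h with hx
    exact absurd ⟨k, ⟨rfl, hk⟩, fun k' hk' => hF.eq_of_depth_eq hk'.2 hk hk'.1⟩ hx
  | some k' =>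
    obtain ⟨h1, h2⟩ := regionAt_eq_some h
    rw [hF.eq_of_depth_eq h2 hk h1]

/-- The outcome of the loop over the depths `a, …, a + n - 1`: it either runs to the end or stops
at a region `j`. -/
theorem IsForest.depthLoop_spec (hF : F.IsForest) (x : Fin m) (n a : ℕ) (s : CurveState K) :
    ((F.depthLoop x (List.range' a n) s).P = s.P ∧
      (F.depthLoop x (List.range' a n) s).Kminus = s.Kminus ∧
      (∀ k, (F.depthLoop x (List.range' a n) s).η k =
        if x ∈ F.R k ∧ a ≤ F.depth k ∧ F.depth k < a + n then s.η k + 1 else s.η k) ∧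
      ∀ k, x ∈ F.R k → a ≤ F.depth k → F.depth k < a + n → s.η k + 1 < F.ζ k) ∨
    ∃ j, x ∈ F.R j ∧ a ≤ F.depth j ∧ F.ζ j ≤ s.η j + 1 ∧
      (F.depthLoop x (List.range' a n) s).P = (s.P \ s.P.filter fun k => F.R k ⊆ F.R j) ∪ {j} ∧
      (F.depthLoop x (List.range' a n) s).Kminus = s.Kminus ∪ {j} ∧
      (∀ k, (F.depthLoop x (List.range' a n) s).η k =
        if x ∈ F.R k ∧ a ≤ F.depth k ∧ F.depth k ≤ F.depth j then s.η k + 1 else s.η k) ∧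
      ∀ k, x ∈ F.R k → a ≤ F.depth k → F.depth k < F.depth j → s.η k + 1 < F.ζ k := by
  induction n generalizing a s with
  | zero =>
    refine .inl ⟨rfl, rfl, fun k => ?_, fun k _ _ _ => by omega⟩
    rw [if_neg (by omega)]; rfl
  | succ n ih =>
    rw [List.range'_succ]
    cases hr : F.regionAt x a with
    | none =>
      have hne : ∀ k, x ∈ F.R k → F.depth k ≠ a := by
        rintro k hk rfl
        rw [hF.regionAt_depth hk] at hr
        cases hr
      simp only [depthLoop, hr]
      rcases ih (a + 1) s with ⟨h1, h2, h3, h4⟩ | ⟨j, hj, hja, h0, h1, h2, h3, h4⟩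
      · refine .inl ⟨h1, h2, fun k => ?_, fun k hk _ _ => ?_⟩
        · rw [h3]
          have := hne k
          exact if_congr (and_congr_right fun hk => by have := this hk; omega) rfl rfl
        · have := hne k hk
          exact h4 k hk (by omega) (by omega)
      · refine .inr ⟨j, hj, by omega, h0, h1, h2, fun k => ?_, fun k hk _ _ => ?_⟩
        · rw [h3]
          have := hne k
          exact if_congr (and_congr_right fun hk => by have := this hk; omega) rfl rfl
        · have := hne k hk
          exact h4 k hk (by omega) (by omega)
    | some r =>
      obtain ⟨hra, hrx⟩ := regionAt_eq_some hr
      have hne : ∀ k, x ∈ F.R k → k ≠ r → F.depth k ≠ a := fun k hk hkr h =>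
        hkr (hF.eq_of_depth_eq hk hrx (h.trans hra.symm))
      simp only [depthLoop, hr]
      split_ifs with hlt
      · rcases ih (a + 1) { s with η := Function.update s.η r (s.η r + 1) } with
          ⟨h1, h2, h3, h4⟩ | ⟨j, hj, hja, h0, h1, h2, h3, h4⟩
        · refine .inl ⟨h1, h2, fun k => ?_, fun k hk _ _ => ?_⟩
          · rw [h3]
            by_cases hkr : k = r
            · subst hkr
              simp [hra, hrx]
            · dsimp only
              rw [Function.update_of_ne hkr]
              exact if_congr (and_congr_right fun hk => by have := hne k hk hkr; omega) rfl rfl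
          · by_cases hkr : k = r
            · exact hkr ▸ hlt
            · have := hne k hk hkr
              simpa [Function.update_of_ne hkr] using h4 k hk (by omega) (by omega)
        -- The remaining loop starts at depth $a+1$, so it cannot stop at $r$, whose counter has
        -- already been raised.
        · have hjr : j ≠ r := by rintro rfl; omega
          dsimp only at h0
          rw [Function.update_of_ne hjr] at h0
          refine .inr ⟨j, hj, by omega, h0, h1, h2, fun k => ?_, fun k hk _ _ => ?_⟩
          · rw [h3]
            by_cases hkr : k = r
            · subst hkr
              dsimp only
              rw [if_neg (by omega), if_pos ⟨hrx, by omega, by omega⟩, Function.update_self]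
            · dsimp only
              rw [Function.update_of_ne hkr]
              exact if_congr (and_congr_right fun hk => by have := hne k hk hkr; omega) rfl rfl
          · by_cases hkr : k = r
            · exact hkr ▸ hlt
            · have := hne k hk hkr
              simpa [Function.update_of_ne hkr] using h4 k hk (by omega) (by omega)
      · refine .inr ⟨r, hrx, hra.ge, by omega, rfl, rfl, fun k => ?_, fun k _ _ _ => by omega⟩
        dsimp only
        by_cases hkr : k = r
        · subst hkr
          rw [if_pos ⟨hrx, by omega, le_rfl⟩, Function.update_self]
        · rw [Function.update_of_ne hkr, if_neg]
          rintro ⟨hk, h1, h2⟩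
          exact hne k hk hkr (by omega)

/-! ### Preservation of the invariant by one step. -/

namespace CurveInvariant

variable {S : Finset (Fin m)} {s : CurveState K} {x : Fin m}

theorem eq_of_mem (hI : F.CurveInvariant S s) {p q : K} (hp : p ∈ s.P) (hq : q ∈ s.P)
    (hxp : x ∈ F.R p) (hxq : x ∈ F.R q) : p = q := by
  by_contra h
  exact disjoint_left.1 (hI.partition.2.1 p hp q hq h) hxp hxq

theorem vstar_insert_frozen (hF : F.IsForest) (hI : F.CurveInvariant S s) {k : K}
    (hk : k ∈ s.Kminus) (hx : x ∈ F.R k) {T : Finset (Fin m)}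
    (hT : T = univ ∨ ∃ k, (∃ p ∈ s.P, F.R p ⊆ F.R k) ∧ T = F.R k) :
    F.vstar (insert x S ∩ T) = F.vstar (S ∩ T) := by
  rcases hI.covered k hk with h0 | ⟨q, hq, hkq⟩
  · exact vstar_insert_of_zeta_eq_zero hx h0 S T
  have hsat : F.R k ⊆ T → _ := hF.vstar_insert_of_saturated hx (hI.saturated k hk)
  rcases hT with rfl | ⟨l, ⟨p, hp, hpl⟩, rfl⟩
  · exact hsat (subset_univ _)
  by_cases hxl : x ∈ F.R l
  · rcases hF.subset_or_subset hx hxl with h | h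
    · exact hsat h
    -- Here $R_p\subseteq R_l\subseteq R_k\subseteq R_q$ with $p,q\in\mathcal P$, so $p=q$ and all
    -- four regions coincide.
    · obtain ⟨y, hy⟩ := hI.partition.1 p hp
      obtain rfl := hI.eq_of_mem hp hq hy (hkq (h (hpl hy)))
      exact hsat (hkq.trans hpl)
  · rw [Finset.insert_inter_of_notMem hxl]

theorem insert_frozen (hF : F.IsForest) (hI : F.CurveInvariant S s) {k : K}
    (hk : k ∈ s.Kminus) (hx : x ∈ F.R k) : F.CurveInvariant (insert x S) s := by
  have hv : ∀ l, (∃ p ∈ s.P, F.R p ⊆ F.R l) →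
      F.vstar (insert x S ∩ F.R l) = F.vstar (S ∩ F.R l) := fun l hl =>
    hI.vstar_insert_frozen hF hk hx (.inr ⟨l, hl, rfl⟩)
  have hvP : ∀ p ∈ s.P, F.vstar (insert x S ∩ F.R p) = F.vstar (S ∩ F.R p) := fun p hp =>
    hv p ⟨p, hp, Subset.rfl⟩
  refine ⟨hI.partition, fun l hl => (hv l hl).trans (hI.vstar_eq l hl), fun l hl => ?_,
    hI.covered, hI.leaf_or_mem, fun l hl hlm => (hv l hl).trans_lt (hI.unsaturated l hl hlm),
    fun T hT => ?_, ?_, fun hz p hp => ?_⟩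
  · refine (F.vstar_inter_region_le _ l).antisymm ((hI.saturated l hl).ge.trans ?_)
    exact vstar_mono (inter_subset_inter_right (subset_insert _ _))
  · rw [hI.vstar_insert_frozen hF hk hx hT, hI.vstar_eq_sum T hT]
    exact sum_congr rfl fun p hp => (hvP p (mem_filter.1 hp).1).symm
  · rw [← hI.vstar_eq_level]
    simpa using hI.vstar_insert_frozen hF hk hx (.inl rfl)
  · by_cases hxp : x ∈ F.R p
    · have hsat : F.vstar (S ∩ F.R p) = F.ζ p := by
        -- The extra hypothesis is needed here: a leaf with $\zeta>0$ inside a region with $\zeta=0$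
        -- has bound $0$, yet its minimum becomes positive once it is hit.
        rcases hI.leaf_or_mem p hp with hl | hm
        · rcases hI.covered k hk with h0 | ⟨q, hq, hkq⟩
          · have h1 := hz k h0 p hl (subset_of_mem_leaves hl hxp hx)
            have h2 := F.vstar_inter_region_le S p
            omega
          · obtain rfl := hI.eq_of_mem hp hq hxp (hkq hx)
            obtain rfl := F.R_injective (hkq.antisymm (subset_of_mem_leaves hl hxp hx))
            exact hI.saturated k hk
        · exact hI.saturated p hm
      rw [hvP p hp, hsat, eq_comm, min_eq_left_iff, ← hsat]
      exact (vstar_mono (inter_subset_inter_right (subset_insert _ _))).trans (vstar_le_card _ _)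
    · rw [Finset.insert_inter_of_notMem hxp]
      exact hI.vstar_eq_min hz p hp

/-- Effect of counting an element that is not frozen, when the loop stops at the region `j` or,
if it does not stop early, when `j` is the leaf of that element. -/
theorem insert_of_not_frozen (hF : F.IsForest) (hI : F.CurveInvariant S s) (hxS : x ∉ S)
    (hx : ∀ k ∈ s.Kminus, x ∉ F.R k) {s' : CurveState K} {j : K} (hj : x ∈ F.R j)
    (hP : s'.P = (s.P \ s.P.filter fun k => F.R k ⊆ F.R j) ∪ {j})
    (hη : ∀ k, s'.η k = if x ∈ F.R k ∧ F.R j ⊆ F.R k then s.η k + 1 else s.η k)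
    (hlt : ∀ k, F.R j ⊂ F.R k → s.η k + 1 < F.ζ k)
    (hK : s'.Kminus = s.Kminus ∪ {j} ∧ F.ζ j ≤ s.η j + 1 ∨
      s'.Kminus = s.Kminus ∧ j ∈ F.leaves ∧ s.η j + 1 < F.ζ j) :
    F.CurveInvariant (insert x S) s' := by
  have hmemP : ∀ p, p ∈ s'.P ↔ p ∈ s.P ∧ ¬F.R p ⊆ F.R j ∨ p = j := fun p => by
    simp [hP]; tauto
  have hmemK : ∀ k, k ∈ s'.Kminus → k ∈ s.Kminus ∨ k = j ∧ F.ζ j ≤ s.η j + 1 := fun k hk => by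
    rcases hK with ⟨h, h'⟩ | ⟨h, -, -⟩
    · rw [h, mem_union, mem_singleton] at hk
      exact hk.imp_right fun h => ⟨h, h'⟩
    · exact .inl (h ▸ hk)
  have hsubK : s.Kminus ⊆ s'.Kminus := by
    rcases hK with ⟨h, -⟩ | ⟨h, -, -⟩ <;> rw [h]
    exact subset_union_left
  have hjP : j ∈ s'.P := (hmemP j).2 (.inr rfl)
  obtain ⟨q, hq, hxq⟩ := hI.partition.2.2 x
  -- As $x$ is not frozen, its part is a leaf; hence every region through $x$ lies above $\mathcal
  -- P$, is unsaturated and has a correct counter.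
  have hql : q ∈ F.leaves := (hI.leaf_or_mem q hq).resolve_right fun h => hx q h hxq
  have hqk : ∀ k, x ∈ F.R k → F.R q ⊆ F.R k := fun k hk => subset_of_mem_leaves hql hxq hk
  have habx : ∀ k, x ∈ F.R k → ∃ p ∈ s.P, F.R p ⊆ F.R k := fun k hk => ⟨q, hq, hqk k hk⟩
  have hpx : ∀ p ∈ s.P, ¬F.R p ⊆ F.R j → x ∉ F.R p := fun p hp hpj hxp =>
    hpj (hI.eq_of_mem hq hp hxq hxp ▸ hqk j hj)
  have huns : ∀ k, x ∈ F.R k → F.vstar (S ∩ F.R k) < F.ζ k := fun k hk =>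
    hI.unsaturated k (habx k hk) fun h => hx k h hk
  have hvx : ∀ T, x ∈ T → F.vstar (insert x S ∩ T) = F.vstar (S ∩ T) + 1 := fun T hT =>
    vstar_insert_of_unsaturated hxS hT huns
  have hvn : ∀ T, x ∉ T → F.vstar (insert x S ∩ T) = F.vstar (S ∩ T) := fun T hT => by
    rw [Finset.insert_inter_of_notMem hT]
  have hab : ∀ k, (∃ p ∈ s'.P, F.R p ⊆ F.R k) → ∃ p ∈ s.P, F.R p ⊆ F.R k := by
    rintro k ⟨p, hp, hpk⟩
    rcases (hmemP p).1 hp with ⟨hp, -⟩ | rfl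
    · exact ⟨p, hp, hpk⟩
    · exact habx k (hpk hj)
  -- No region strictly inside $R_j$ remains above the new partition, so the counters skipped by the
  -- break no longer matter.
  have hnot : ∀ k, (∃ p ∈ s'.P, F.R p ⊆ F.R k) → F.R k ⊆ F.R j → F.R j ⊆ F.R k := by
    rintro k ⟨p, hp, hpk⟩ hkj
    rcases (hmemP p).1 hp with ⟨-, hp⟩ | rfl
    · exact absurd (hpk.trans hkj) hp
    · exact hpk
  have hjk : ∀ k, (∃ p ∈ s'.P, F.R p ⊆ F.R k) → x ∈ F.R k → F.R j ⊆ F.R k := fun k hk hxk =>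
    (hF.subset_or_subset hj hxk).elim id (hnot k hk)
  have hηx : ∀ k, x ∈ F.R k → F.vstar (S ∩ F.R k) = s.η k := fun k hk =>
    hI.vstar_eq k (habx k hk)
  have hjsat : F.ζ j ≤ s.η j + 1 → F.vstar (insert x S ∩ F.R j) = F.ζ j := fun h => by
    refine (F.vstar_inter_region_le _ j).antisymm ?_
    rwa [hvx _ hj, hηx j hj]
  refine ⟨⟨fun p hp => ?_, fun p hp p' hp' hne => ?_, fun i => ?_⟩, fun k hk => ?_, fun k hk => ?_,
    fun k hk => ?_, fun p hp => ?_, fun k hk hkm => ?_, fun T hT => ?_, ?_, fun hz p hp => ?_⟩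
  · rcases (hmemP p).1 hp with ⟨hp, -⟩ | rfl
    · exact hI.partition.1 p hp
    · exact ⟨x, hj⟩
  · have hd : ∀ p ∈ s.P, ¬F.R p ⊆ F.R j → Disjoint (F.R p) (F.R j) := fun p hp hpj => by
      rcases hF.subset_or_subset_or_disjoint p j with h | h | h
      · exact absurd h hpj
      · exact absurd (h hj) (hpx p hp hpj)
      · exact h
    rcases (hmemP p).1 hp with ⟨hp, hpj⟩ | rfl <;> rcases (hmemP p').1 hp' with ⟨hp', hpj'⟩ | rfl
    · exact hI.partition.2.1 p hp p' hp' hne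
    · exact hd p hp hpj
    · exact (hd p' hp' hpj').symm
    · exact absurd rfl hne
  · obtain ⟨p, hp, hip⟩ := hI.partition.2.2 i
    by_cases hpj : F.R p ⊆ F.R j
    · exact ⟨j, hjP, hpj hip⟩
    · exact ⟨p, (hmemP p).2 (.inl ⟨hp, hpj⟩), hip⟩
  · rw [hη]
    by_cases hxk : x ∈ F.R k
    · rw [if_pos ⟨hxk, hjk k hk hxk⟩, hvx _ hxk, hηx k hxk]
    · rw [if_neg fun h => hxk h.1, hvn _ hxk, hI.vstar_eq k (hab k hk)]
  · rcases hmemK k hk with hk | ⟨rfl, h⟩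
    · rw [hvn _ (hx k hk), hI.saturated k hk]
    · exact hjsat h
  · rcases hmemK k hk with hk | ⟨rfl, h⟩
    · refine (hI.covered k hk).imp_right ?_
      rintro ⟨p, hp, hkp⟩
      by_cases hpj : F.R p ⊆ F.R j
      · exact ⟨j, hjP, hkp.trans hpj⟩
      · exact ⟨p, (hmemP p).2 (.inl ⟨hp, hpj⟩), hkp⟩
    · exact .inr ⟨k, hjP, Subset.rfl⟩
  · rcases (hmemP p).1 hp with ⟨hp, -⟩ | rfl
    · exact (hI.leaf_or_mem p hp).imp_right fun h => hsubK h
    · rcases hK with ⟨h, -⟩ | ⟨-, h, -⟩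
      · exact .inr (by simp [h])
      · exact .inl h
  · by_cases hxk : x ∈ F.R k
    · rw [hvx _ hxk, hηx k hxk]
      by_cases hkj : F.R k ⊆ F.R j
      · obtain rfl := F.R_injective (hkj.antisymm (hjk k hk hxk))
        rcases hK with ⟨h, -⟩ | ⟨-, -, h⟩
        · exact absurd (by simp [h]) hkm
        · exact h
      · exact hlt k ⟨hjk k hk hxk, hkj⟩
    · rw [hvn _ hxk]
      exact hI.unsaturated k (hab k hk) fun h => hkm (hsubK h)
  · have hold := hI.vstar_eq_sum T (hT.imp_right fun ⟨k, hk, h⟩ => ⟨k, hab k hk, h⟩)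
    rw [← sum_filter_add_sum_filter_not _ (fun p => F.R p ⊆ F.R j), filter_filter,
      filter_filter] at hold
    have hrest : ∑ p ∈ s.P with F.R p ⊆ T ∧ ¬F.R p ⊆ F.R j, F.vstar (insert x S ∩ F.R p) =
        ∑ p ∈ s.P with F.R p ⊆ T ∧ ¬F.R p ⊆ F.R j, F.vstar (S ∩ F.R p) :=
      sum_congr rfl fun p hp => by
        rw [mem_filter] at hp
        exact hvn _ (hpx p hp.1 hp.2.2)
    by_cases hxT : x ∈ T
    · have hjT : F.R j ⊆ T := by
        rcases hT with rfl | ⟨k, hk, rfl⟩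
        · exact subset_univ _
        · exact hjk k hk hxT
      have hset : (s'.P.filter fun p => F.R p ⊆ T) =
          insert j (s.P.filter fun p => F.R p ⊆ T ∧ ¬F.R p ⊆ F.R j) := by
        ext p
        simp only [mem_filter, mem_insert, hmemP]
        constructor
        · rintro ⟨⟨h1, h2⟩ | h1, h3⟩
          · exact .inr ⟨h1, h3, h2⟩
          · exact .inl h1
        · rintro (rfl | ⟨h1, h2, h3⟩)
          · exact ⟨.inr rfl, hjT⟩
          · exact ⟨.inl ⟨h1, h3⟩, h2⟩
      have hsub : (s.P.filter fun p => F.R p ⊆ T ∧ F.R p ⊆ F.R j) =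
          s.P.filter fun p => F.R p ⊆ F.R j :=
        filter_congr fun p _ => ⟨And.right, fun h => ⟨h.trans hjT, h⟩⟩
      -- The parts absorbed by $j$ contributed exactly $V^*(S\cap R_j)$, by the same identity for
      -- $T=R_j$; both sides then grow by one.
      rw [hsub, ← hI.vstar_eq_sum (F.R j) (.inr ⟨j, habx j hj, rfl⟩)] at hold
      rw [hset, sum_insert (by simp), hrest, hvx _ hxT, hvx _ hj, hold]
      omega
    · obtain ⟨k, hk, rfl⟩ := hT.resolve_left fun h => hxT (h ▸ mem_univ x)
      have hd : Disjoint (F.R k) (F.R j) := by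
        rcases hF.subset_or_subset_or_disjoint k j with h | h | h
        · exact absurd (hnot k hk h hj) hxT
        · exact absurd (h hj) hxT
        · exact h
      have hset : (s'.P.filter fun p => F.R p ⊆ F.R k) =
          s.P.filter fun p => F.R p ⊆ F.R k ∧ ¬F.R p ⊆ F.R j := by
        ext p
        simp only [mem_filter, hmemP]
        constructor
        · rintro ⟨⟨h1, h2⟩ | rfl, h3⟩
          · exact ⟨h1, h3, h2⟩
          · exact absurd (h3 hj) hxT
        · rintro ⟨h1, h2, h3⟩
          exact ⟨.inl ⟨h1, h3⟩, h2⟩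
      have hempty : (s.P.filter fun p => F.R p ⊆ F.R k ∧ F.R p ⊆ F.R j) = ∅ := by
        refine filter_eq_empty_iff.2 fun p hp h => ?_
        obtain ⟨y, hy⟩ := hI.partition.1 p hp
        exact disjoint_left.1 hd (h.1 hy) (h.2 hy)
      rw [hempty, sum_empty, zero_add] at hold
      rw [hset, hrest, hvn _ hxT, hold]
  -- Exactly one root contains $x$; it contains $R_j$, so its counter is the only one of depth $1$
  -- that is raised.
  · obtain ⟨r, hxr, hr⟩ := exists_depth_eq_one hj
    have hrl : r ∈ F.level 1 := by simp [level, hr]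
    have h1 := hvx univ (mem_univ x)
    simp only [inter_univ] at h1
    rw [h1, hI.vstar_eq_level, ← add_sum_erase _ _ hrl, ← add_sum_erase _ _ hrl, hη,
      if_pos ⟨hxr, hF.subset_of_depth_le hxr hj (hr.le.trans (F.one_le_depth j))⟩]
    have : ∑ k ∈ (F.level 1).erase r, s'.η k = ∑ k ∈ (F.level 1).erase r, s.η k := by
      refine sum_congr rfl fun k hk => ?_
      rw [hη, if_neg]
      rintro ⟨hxk, -⟩
      simp only [mem_erase, level, mem_filter, mem_univ, true_and] at hk
      exact hk.1 (hF.eq_of_depth_eq hxk hxr (hk.2.trans hr.symm))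
    omega
  · rcases (hmemP p).1 hp with ⟨hp, hpj⟩ | rfl
    · have hxp := hpx p hp hpj
      rw [Finset.insert_inter_of_notMem hxp]
      exact hI.vstar_eq_min hz p hp
    · rcases hK with ⟨-, h⟩ | ⟨-, hl, h⟩
      · rw [hjsat h, eq_comm, min_eq_left_iff, ← hjsat h]
        exact vstar_le_card _ _
      -- The leaf is still below $\zeta$ after the increment, so the minimum is the cardinality
      -- before and after.
      · obtain rfl := eq_of_mem_leaves hql hl hxq hj
        have h1 := hI.vstar_eq_min hz q hq
        rw [hvx _ hj, insert_inter_of_mem hj,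
          card_insert_of_notMem fun h => hxS (mem_inter.1 h).1]
        have := hηx q hj
        omega

theorem step (hF : F.IsForest) (hI : F.CurveInvariant S s) (hxS : x ∉ S) :
    F.CurveInvariant (insert x S) (F.step x s) := by
  unfold ReferenceFamily.step
  split_ifs with hx
  · obtain ⟨k, hk, hxk⟩ := hx
    exact hI.insert_frozen hF hk hxk
  push Not at hx
  rcases hF.depthLoop_spec x (F.hmax x) 1 s with ⟨h1, h2, h3, h4⟩ | ⟨j, hj, -, h0, h1, h2, h3, h4⟩
  · obtain ⟨q, hq, hxq⟩ := hI.partition.2.2 x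
    have hql : q ∈ F.leaves := (hI.leaf_or_mem q hq).resolve_right fun h => hx q h hxq
    have h4' : ∀ k, x ∈ F.R k → s.η k + 1 < F.ζ k := fun k hk =>
      h4 k hk (F.one_le_depth k) (by have := depth_le_hmax hk; omega)
    -- Without a break, $j$ is the leaf $q$ of $x$: replacing the parts inside $R_q$ by $q$ leaves
    -- $\mathcal P$ unchanged.
    refine hI.insert_of_not_frozen hF hxS hx hxq ?_ (fun k => ?_) (fun k hk => h4' k (hk.1 hxq))
      (.inr ⟨h2, hql, h4' q hxq⟩)
    · rw [h1]
      ext p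
      simp only [mem_union, mem_sdiff, mem_filter, mem_singleton, not_and]
      refine ⟨fun hp => ?_, ?_⟩
      · by_cases hpq : F.R p ⊆ F.R q
        · obtain ⟨y, hy⟩ := hI.partition.1 p hp
          exact .inr (hI.eq_of_mem hp hq hy (hpq hy))
        · exact .inl ⟨hp, fun _ => hpq⟩
      · rintro (h | rfl)
        · exact h.1
        · exact hq
    · rw [h3]
      refine if_congr (and_congr_right fun hk => ?_) rfl rfl
      have := depth_le_hmax hk
      have := F.one_le_depth k
      exact iff_of_true (by omega) (subset_of_mem_leaves hql hxq hk)
  · refine hI.insert_of_not_frozen hF hxS hx hj h1 (fun k => ?_) (fun k hk => ?_) (.inl ⟨h2, h0⟩)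
    · rw [h3]
      refine if_congr (and_congr_right fun hk => ⟨fun h => hF.subset_of_depth_le hk hj h.2,
        fun h => ⟨F.one_le_depth k, ?_⟩⟩) rfl rfl
      rcases h.eq_or_ssubset with h | h
      · rw [F.R_injective h]
      · exact (depth_lt_of_ssubset h).le
    · exact h4 k (hk.1 hj) (F.one_le_depth k) (depth_lt_of_ssubset hk)

end CurveInvariant

/-! ### Induction along the selection path and conclusion. -/

theorem curveInvariant_curveState (hF : F.IsForest) (hc : F.IsComplete) (σ : Equiv.Perm (Fin m))
    {t : ℕ} (ht : t ≤ m) : F.CurveInvariant (selectionPath σ t) (F.curveState σ t) := by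
  induction t with
  | zero => simpa [selectionPath, curveState] using curveInvariant_initState hc
  | succ t ih =>
    have hset : selectionPath σ (t + 1) = insert (σ ⟨t, ht⟩) (selectionPath σ t) := by
      rw [selectionPath, selectionPath, ← image_insert]
      congr 1
      ext j
      simp only [mem_filter, mem_univ, true_and, mem_insert, Fin.ext_iff]
      omega
    have hmem : σ ⟨t, ht⟩ ∉ selectionPath σ t := by
      simp [selectionPath]
    rw [hset, curveState, dif_pos (Nat.lt_of_succ_le ht)]
    exact (ih (Nat.le_of_succ_le ht)).step hF hmem

end ReferenceFamily

theorem mainTheorem1 {m : ℕ} {K : Type*} [Fintype K] [DecidableEq K]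
    (F : ReferenceFamily m K) (hforest : F.IsForest) (hcomplete : F.IsComplete)
    (σ : Equiv.Perm (Fin m)) (t : ℕ) (ht : t ≤ m) :
    F.RealizesPartition (F.curveState σ t).P ∧
    (∀ k ∈ F.above σ t,
      F.vstar (selectionPath σ t ∩ F.R k) = (F.curveState σ t).η k) ∧
    F.vstar (selectionPath σ t) = ∑ k ∈ F.level 1, (F.curveState σ t).η k ∧
    ((∀ k, F.ζ k = 0 → ∀ l ∈ F.leaves, F.R l ⊆ F.R k → F.ζ l = 0) →
      (∀ k ∈ F.above σ t,
        F.vstar (selectionPath σ t ∩ F.R k) =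
          ∑ k' ∈ (F.curveState σ t).P with F.R k' ⊆ F.R k,
            min (F.ζ k') (selectionPath σ t ∩ F.R k').card) ∧
      F.vstar (selectionPath σ t) =
        ∑ k ∈ (F.curveState σ t).P,
          min (F.ζ k) (selectionPath σ t ∩ F.R k).card) := by
  have hI := ReferenceFamily.curveInvariant_curveState hforest hcomplete σ ht
  have habove : ∀ k ∈ F.above σ t, ∃ p ∈ (F.curveState σ t).P, F.R p ⊆ F.R k := fun k hk => by
    simpa [ReferenceFamily.above] using hk
  refine ⟨hI.partition, fun k hk => hI.vstar_eq k (habove k hk), hI.vstar_eq_level,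
    fun hz => ⟨fun k hk => ?_, ?_⟩⟩
  · rw [hI.vstar_eq_sum _ (.inr ⟨k, habove k hk, rfl⟩)]
    exact sum_congr rfl fun p hp => hI.vstar_eq_min hz p (mem_filter.1 hp).1
  · have h := hI.vstar_eq_sum univ (.inl rfl)
    simp only [inter_univ, subset_univ, filter_true] at h
    rw [h]
    exact sum_congr rfl fun p hp => hI.vstar_eq_min hz p hp
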